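/- **Setting.** Formulas of the modal $\mu$-calculus over an infinite set $\mathsf{Var}$ of variables and a set $\mathsf{Prop}$ of propositional constants are generated by $p \mid \neg p \mid x \mid \bigvee\Gamma \mid \bigwedge\Gamma \mid \nabla\Gamma \mid \mu x\,\phi \mid \nu x\,\phi$, with $\Gamma$ a finite set of formulas, and have the usual semantics in Kripke frames $\mathcal S=(S,R,\Lambda)$ with $S\neq\emptyset$; a state $v$ satisfies $\nabla\Gamma$ iff some $\gamma\in\Gamma$ holds at all successors of $v$, or some successor of $v$ satisfies all $\gamma\in\Gamma$. An *equational formula* $\phi=(X,x_0,E)$ (the presentation of formulas of the $\Sigma$-fragment used here) consists of a finite set $X\subseteq\mathsf{Var}$, a variable $x_0\in X$, and for each $x\in X$ a formula $E(x)$ obtained from literals, closed formulas and variables in $X$ by $\bigvee,\bigwedge,\nabla$, in which every free occurrence of a variable is in the scope of a $\nabla$. For ordinals $\alpha$ let $V^\alpha(x)=\bigcup_{\beta<\alpha}[\![E(x)]\!]^{\mathcal S}_{V^\beta}$ for $x\in X$ and $V^\alpha(x)=\emptyset$ for $x\notin X$. Put $[\![\phi^\alpha]\!]^{\mathcal S}=V^\alpha(x_0)$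 and $[\![\phi]\!]^{\mathcal S}=\bigcup_{\alpha<\omega_1}[\![\phi^\alpha]\!]^{\mathcal S}$. Let $\mathrm{CO}_{\mathcal S}(\phi)$ be the least $\kappa$ with $[\![\phi^\kappa]\!]^{\mathcal S}=[\![\phi]\!]^{\mathcal S}$, and let $\mathrm{CO}(\phi)$ be the least $\kappa$ with $\mathrm{CO}_{\mathcal S}(\phi)\le\kappa$ for all countable frames $\mathcal S$. The formula $\phi$ is *conjunctive* if every $E(x)$ is of the form $\bigwedge_{i<k}(\bigvee\Gamma_i\vee\nabla Y_i)$ with $\Gamma_i$ a finite set of closed formulas and $Y_i\subseteq X$. **Theorem.** For every equational formula $\phi$ there is a conjunctive equational formula $\phi_c$ that is equivalent to $\phi$ (that is, $[\![\phi_c]\!]^{\mathcal S}=[\![\phi]\!]^{\mathcal S}$ for every frame $\mathcal S$) such that $\mathrm{CO}(\phi)\le\mathrm{CO}(\phi_c)$, and $\mathrm{CO}(\phi)<\omega_1$ implies $\mathrm{CO}(\phi_c)<\omega_1$. -/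

import Mathlib

namespace MuCalc

/-- Formulas of the modal mu-calculus over variables `Var` and propositional constants `P`.
A finite set of formulas is presented by a finite family `Fin n → Formula Var P`; the semantics
depends only on the set of its members. -/
inductive Formula (Var : Type*) (P : Type*) where
  | pos (p : P) : Formula Var P
  | neg (p : P) : Formula Var P
  | var (x : Var) : Formula Var P
  | disj {n : ℕ} (Γ : Fin n → Formula Var P) : Formula Var P
  | conj {n : ℕ} (Γ : Fin n → Formula Var P) : Formula Var P
  | nabla {n : ℕ} (Γ : Fin n → Formula Var P) : Formula Var P
  | mu (x : Var) (φ : Formula Var P) : Formula Var P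
  | nu (x : Var) (φ : Formula Var P) : Formula Var P

/-- A Kripke frame with (non-empty) set of states `S`. -/
structure Frame (P : Type*) (S : Type*) where
  nonempty : Nonempty S
  R : S → S → Prop
  label : P → Set S

namespace Frame

variable {P S : Type*}

/-- The set `R[s]` of successors of `s`. -/
def succs (F : Frame P S) (s : S) : Set S := {t | F.R s t}

/-- The operator `∇` on families of sets of states: some member contains all successors, or some
successor lies in all members. -/
def nabla (F : Frame P S) (𝒰 : Set (Set S)) : Set S :=
  {v | ∃ U ∈ 𝒰, F.succs v ⊆ U} ∪ {v | (⋂₀ 𝒰 ∩ F.succs v).Nonempty}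

end Frame

namespace Formula

variable {Var P S : Type*}

/-- Binary disjunction `φ ∨ ψ := ⋁ {φ, ψ}`. -/
def or (φ ψ : Formula Var P) : Formula Var P := disj ![φ, ψ]

/-- The set of free variables. -/
def freeVars : Formula Var P → Set Var
  | pos _ => ∅
  | neg _ => ∅
  | var x => {x}
  | disj Γ => ⋃ i, (Γ i).freeVars
  | conj Γ => ⋃ i, (Γ i).freeVars
  | nabla Γ => ⋃ i, (Γ i).freeVars
  | mu x φ => φ.freeVars \ {x}
  | nu x φ => φ.freeVars \ {x}

def Closed (φ : Formula Var P) : Prop := φ.freeVars = ∅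

/-- The variables with a free occurrence that is not in the scope of a modality. -/
def unguardedVars : Formula Var P → Set Var
  | pos _ => ∅
  | neg _ => ∅
  | var x => {x}
  | disj Γ => ⋃ i, (Γ i).unguardedVars
  | conj Γ => ⋃ i, (Γ i).unguardedVars
  | nabla _ => ∅
  | mu x φ => φ.unguardedVars \ {x}
  | nu x φ => φ.unguardedVars \ {x}

/-- Every free occurrence of a variable is in the scope of a modality. -/
def Guarded (φ : Formula Var P) : Prop := φ.unguardedVars = ∅

/-- Quantifier-free formulas over `A`: the closure of `A` and the literals under `⋁`, `⋀`, `∇`. -/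
inductive QF (A : Set (Formula Var P)) : Formula Var P → Prop
  | base {φ : Formula Var P} (h : φ ∈ A) : QF A φ
  | pos (p : P) : QF A (Formula.pos p)
  | neg (p : P) : QF A (Formula.neg p)
  | disj {n : ℕ} {Γ : Fin n → Formula Var P} (h : ∀ i, QF A (Γ i)) : QF A (Formula.disj Γ)
  | conj {n : ℕ} {Γ : Fin n → Formula Var P} (h : ∀ i, QF A (Γ i)) : QF A (Formula.conj Γ)
  | nabla {n : ℕ} {Γ : Fin n → Formula Var P} (h : ∀ i, QF A (Γ i)) : QF A (Formula.nabla Γ)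

/-- The denotation of a formula in the frame `F` relative to the valuation `V`. -/
def den [DecidableEq Var] (F : Frame P S) : Formula Var P → (Var → Set S) → Set S
  | pos p, _ => F.label p
  | neg p, _ => (F.label p)ᶜ
  | var x, V => V x
  | disj Γ, V => ⋃ i, (Γ i).den F V
  | conj Γ, V => ⋂ i, (Γ i).den F V
  | nabla Γ, V => F.nabla (Set.range fun i => (Γ i).den F V)
  | mu x φ, V => ⋂₀ {U | φ.den F (Function.update V x U) ⊆ U}
  | nu x φ, V => ⋃₀ {U | U ⊆ φ.den F (Function.update V x U)}

end Formula

/-- An equation system `(X, E)` over closed formulas: `X` is a finite set of variables and each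
`E x` is a quantifier-free formula over `X` and the closed formulas, all of whose variables are in
the scope of a modality. -/
structure EquationSystem (Var : Type*) (P : Type*) where
  X : Finset Var
  E : {x // x ∈ X} → Formula Var P
  qf : ∀ x, (E x).QF ({φ | ∃ y ∈ X, φ = Formula.var y} ∪ {φ | φ.Closed})
  guarded : ∀ x, (E x).Guarded

namespace EquationSystem

variable {Var P S : Type*}

/-- The valuation `V^α`: the union of the denotations of `E x` at `V^β` over `β < α` for `x ∈ X`,
and empty at the other variables. -/
noncomputable def approx [DecidableEq Var] (Q : EquationSystem Var P) (F : Frame P S)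
    (α : Ordinal.{0}) : Var → Set S :=
  fun x => if h : x ∈ Q.X then ⋃ (β : Ordinal.{0}) (_ : β < α), (Q.E ⟨x, h⟩).den F (approx Q F β)
    else ∅
termination_by α

/-- Every `E x` has the form `⋀_{i<k} (⋁ Γ_i ∨ ∇ Y_i)` with `Γ_i` a finite set of closed formulas
and `Y_i ⊆ X`. -/
def IsConjunctive (Q : EquationSystem Var P) : Prop :=
  ∀ x, ∃ (k : ℕ) (m n : Fin k → ℕ) (Γ : (i : Fin k) → Fin (m i) → Formula Var P)
    (Y : (i : Fin k) → Fin (n i) → Var),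
    (∀ i j, (Γ i j).Closed) ∧ (∀ i j, Y i j ∈ Q.X) ∧
      Q.E x = Formula.conj fun i =>
        (Formula.disj (Γ i)).or (Formula.nabla fun j => Formula.var (Y i j))

end EquationSystem

/-- An equational formula `(X, x₀, E)`: an equation system with an initial variable `x₀ ∈ X`. -/
structure EquationalFormula (Var : Type*) (P : Type*) extends EquationSystem Var P where
  init : Var
  init_mem : init ∈ X

namespace EquationalFormula

variable {Var P S : Type*} [DecidableEq Var]

/-- The denotation of `φ^α`, that is, of the initial variable at `V^α`. -/
noncomputable def approxDen (φ : EquationalFormula Var P) (F : Frame P S) (α : Ordinal.{0}) :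
    Set S :=
  φ.toEquationSystem.approx F α φ.init

/-- The denotation of an equational formula: the union of the denotations of `φ^α`, `α < ω₁`. -/
noncomputable def den (φ : EquationalFormula Var P) (F : Frame P S) : Set S :=
  ⋃ (α : Ordinal.{0}) (_ : α < Ordinal.omega 1), φ.approxDen F α

/-- The closure ordinal of `φ` in the frame `F`: the least `κ` with `φ^κ` and `φ` having the same
denotation. -/
noncomputable def closureOrdinalIn (φ : EquationalFormula Var P) (F : Frame P S) : Ordinal.{0} :=
  sInf {κ | φ.approxDen F κ = φ.den F}

/-- The closure ordinal of `φ`: the least `κ` that bounds the closure ordinals of `φ` in all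
countable frames. -/
noncomputable def closureOrdinal (φ : EquationalFormula Var P) : Ordinal.{0} :=
  sInf {κ | ∀ (S : Type) (_ : Countable S) (F : Frame P S), φ.closureOrdinalIn F ≤ κ}

/-- The set in the definition of `closureOrdinalIn` contains `ω₁`, so it has a least element. -/
theorem approxDen_omega_one (φ : EquationalFormula Var P) (F : Frame P S) :
    φ.approxDen F (Ordinal.omega 1) = φ.den F := by
  have key : ∀ α, φ.approxDen F α = ⋃ (β : Ordinal.{0}) (_ : β < α),
      (φ.E ⟨φ.init, φ.init_mem⟩).den F (φ.toEquationSystem.approx F β) := by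
    intro α
    unfold approxDen
    rw [EquationSystem.approx]
    simp [φ.init_mem]
  ext s
  simp only [den, key, Set.mem_iUnion]
  constructor
  · rintro ⟨β, hβ, hs⟩
    exact ⟨Order.succ β, (Cardinal.isSuccLimit_omega 1).succ_lt hβ, β, Order.lt_succ β, hs⟩
  · rintro ⟨α, hα, β, hβ, hs⟩
    exact ⟨β, hβ.trans hα, hs⟩

/-- The set in the definition of `closureOrdinal` contains `ω₁`, so it has a least element. -/
theorem closureOrdinalIn_le_omega_one (φ : EquationalFormula Var P) (F : Frame P S) :
    φ.closureOrdinalIn F ≤ Ordinal.omega 1 :=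
  csInf_le' (φ.approxDen_omega_one F)

end EquationalFormula

end MuCalc

/-!
An equation system is turned into a conjunctive one by naming, for each set `A` of formulas that
occur below modalities, the disjunction of `A` by a variable `enc A`. The right-hand side for
`enc A` is a conjunctive normal form of the disjunction of the members of `A`, in which the
unguarded variables are first replaced by their (guarded) equations and the formulas directly below
`∇` are then treated as atoms. A disjunction of modalities is eliminated by the distributive law
`∇Γ ∨ ∇Δ = ⋀_Z ∇{γ ∨ δ | (γ, δ) ∈ Z}`, with `Z` ranging over the total and surjective relations
between `Γ` and `Δ` (`Frame.mem_nabla_or_mem_nabla_iff`). It creates new disjunctions below `∇`,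
which are again unions of the given ones and hence have names. A clause without a modality is written
as `(c ∨ ∇∅) ∧ (c ∨ ∇{⊥})`, where `⊥` is the empty disjunction.

Passing to sets of formulas does not change the approximants: at every ordinal `α`, the variable
`enc A` denotes the union over `ψ ∈ A` of the denotations of `enc {ψ}`
(`EquationalFormula.toConjunctive_approx_enc`). What does change them is the unfolding of nested
modalities, as each modality now costs one step. The approximants of the new system therefore lie
below those of the old one (`EquationalFormula.stateApprox_subset_den`). Since modal depths are
finite, the delay is less than `ω` for each step of the old system, so that its `α`-th approximant
lies below approximant `ω * α + 1` of the new one (`EquationalFormula.den_subset_stateApprox`). As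
`ω * α + 1 < ω₁` for `α < ω₁`, the two formulas are equivalent, and both statements on closure
ordinals follow from the two inclusions.
-/

namespace MuCalc

/-! ### The modality `∇` -/

namespace Frame

variable {P S ι κ : Type*}

theorem mem_nabla_image (F : Frame P S) (f : ι → Set S) (A : Set ι) (v : S) :
    v ∈ F.nabla (f '' A) ↔
      (∃ a ∈ A, ∀ t, F.R v t → t ∈ f a) ∨ ∃ t, F.R v t ∧ ∀ a ∈ A, t ∈ f a := by
  simp only [nabla, succs, Set.mem_union, Set.mem_ofPred_eq, Set.exists_mem_image]
  refine or_congr Iff.rfl ?_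
  constructor
  · rintro ⟨t, ht, hR⟩
    exact ⟨t, hR, fun a ha => ht _ ⟨a, ha, rfl⟩⟩
  · rintro ⟨t, hR, ht⟩
    refine ⟨t, ?_, hR⟩
    rintro _ ⟨a, ha, rfl⟩
    exact ht a ha

theorem mem_nabla_range (F : Frame P S) (f : ι → Set S) (v : S) :
    v ∈ F.nabla (Set.range f) ↔
      (∃ a, ∀ t, F.R v t → t ∈ f a) ∨ ∃ t, F.R v t ∧ ∀ a, t ∈ f a := by
  rw [← Set.image_univ, mem_nabla_image]
  simp

theorem nabla_range_mono (F : Frame P S) {f g : ι → Set S} (h : ∀ i, f i ⊆ g i) :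
    F.nabla (Set.range f) ⊆ F.nabla (Set.range g) := by
  intro v
  rw [mem_nabla_range, mem_nabla_range]
  rintro (⟨a, ha⟩ | ⟨t, hR, ht⟩)
  · exact Or.inl ⟨a, fun t hR => h a (ha t hR)⟩
  · exact Or.inr ⟨t, hR, fun a => h a (ht a)⟩

/-- The distributive law `∇Γ ∨ ∇Δ = ⋀_Z ∇{γ ∨ δ | (γ, δ) ∈ Z}`, where `Z` ranges over the relations
between `Γ` and `Δ` that are total and surjective. If both disjuncts fail at `v`, the relation
"some successor of `v` refutes both `γ` and `δ`" is such a `Z`, and its conjunct fails. -/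
theorem mem_nabla_or_mem_nabla_iff (F : Frame P S) (f : ι → Set S) (g : κ → Set S)
    (A : Set ι) (B : Set κ) (v : S) :
    (v ∈ F.nabla (f '' A) ∨ v ∈ F.nabla (g '' B)) ↔
      ∀ Z ⊆ A ×ˢ B, (∀ a ∈ A, ∃ b, (a, b) ∈ Z) → (∀ b ∈ B, ∃ a, (a, b) ∈ Z) →
        v ∈ F.nabla ((fun p : ι × κ => f p.1 ∪ g p.2) '' Z) := by
  constructor
  · rintro h Z hZ hA hB
    rw [mem_nabla_image, mem_nabla_image] at h
    rw [mem_nabla_image]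
    rcases h with (⟨a, ha, h⟩ | ⟨t, hR, h⟩) | (⟨b, hb, h⟩ | ⟨t, hR, h⟩)
    · obtain ⟨b, hb⟩ := hA a ha
      exact Or.inl ⟨_, hb, fun t hR => Or.inl (h t hR)⟩
    · exact Or.inr ⟨t, hR, fun p hp => Or.inl (h _ (hZ hp).1)⟩
    · obtain ⟨a, ha⟩ := hB b hb
      exact Or.inl ⟨_, ha, fun t hR => Or.inr (h t hR)⟩
    · exact Or.inr ⟨t, hR, fun p hp => Or.inr (h _ (hZ hp).2)⟩
  · intro h
    by_contra hcon
    rw [mem_nabla_image, mem_nabla_image] at hcon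
    push Not at hcon
    obtain ⟨⟨hA₁, hA₂⟩, hB₁, hB₂⟩ := hcon
    have := h {p | p.1 ∈ A ∧ p.2 ∈ B ∧ ∃ t, F.R v t ∧ t ∉ f p.1 ∧ t ∉ g p.2}
      (fun p hp => ⟨hp.1, hp.2.1⟩)
      (fun a ha => by
        obtain ⟨t, hR, ht⟩ := hA₁ a ha
        obtain ⟨b, hb, htb⟩ := hB₂ t hR
        exact ⟨b, ha, hb, t, hR, ht, htb⟩)
      (fun b hb => by
        obtain ⟨t, hR, ht⟩ := hB₁ b hb
        obtain ⟨a, ha, hta⟩ := hA₂ t hR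
        exact ⟨a, ha, hb, t, hR, hta, ht⟩)
    rw [mem_nabla_image] at this
    rcases this with ⟨p, ⟨-, -, t, hR, h₁, h₂⟩, hp⟩ | ⟨t, hR, ht⟩
    · exact (hp t hR).elim h₁ h₂
    · obtain ⟨a, ha, hta⟩ := hA₂ t hR
      obtain ⟨b, hb, htb⟩ := hB₂ t hR
      exact (ht (a, b) ⟨ha, hb, t, hR, hta, htb⟩).elim hta htb

end Frame

/-! ### Denotations, and the subformulas below modalities -/

namespace Formula

variable {Var P S : Type*}

theorem den_subset_den [DecidableEq Var] (F : Frame P S) (φ : Formula Var P) :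
    ∀ {V V' : Var → Set S}, (∀ x ∈ φ.freeVars, V x ⊆ V' x) → φ.den F V ⊆ φ.den F V' := by
  have upd : ∀ {φ : Formula Var P} {x : Var} {V V' : Var → Set S} (U : Set S),
      (∀ y ∈ φ.freeVars \ {x}, V y ⊆ V' y) →
      ∀ y ∈ φ.freeVars, Function.update V x U y ⊆ Function.update V' x U y := by
    intro φ x V V' U h y hy
    by_cases hyx : y = x
    · subst hyx; simp
    · simpa [Function.update_of_ne hyx] using h y ⟨hy, hyx⟩
  induction φ with
  | pos p => intro V V' _; exact subset_rfl
  | neg p => intro V V' _; exact subset_rfl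
  | var x => intro V V' h; exact h x rfl
  | disj Γ ih =>
    intro V V' h
    exact Set.iUnion_mono fun i => ih i fun x hx => h x (Set.mem_iUnion_of_mem i hx)
  | conj Γ ih =>
    intro V V' h
    exact Set.iInter_mono fun i => ih i fun x hx => h x (Set.mem_iUnion_of_mem i hx)
  | nabla Γ ih =>
    intro V V' h
    exact F.nabla_range_mono fun i => ih i fun x hx => h x (Set.mem_iUnion_of_mem i hx)
  | mu x φ ih =>
    intro V V' h
    exact Set.sInter_subset_sInter fun U hU => (ih (upd U h)).trans hU
  | nu x φ ih =>
    intro V V' h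
    exact Set.sUnion_subset_sUnion fun U hU => Set.Subset.trans hU (ih (upd U h))

theorem den_mono [DecidableEq Var] (F : Frame P S) (φ : Formula Var P) {V V' : Var → Set S}
    (h : ∀ x, V x ⊆ V' x) : φ.den F V ⊆ φ.den F V' :=
  den_subset_den F φ fun x _ => h x

theorem Closed.den_eq [DecidableEq Var] (F : Frame P S) {φ : Formula Var P} (h : φ.Closed)
    (V V' : Var → Set S) : φ.den F V = φ.den F V' := by
  have h' : ∀ x, x ∉ φ.freeVars := by rw [h]; simp
  exact (den_subset_den F φ fun x hx => (h' x hx).elim).antisymm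
    (den_subset_den F φ fun x hx => (h' x hx).elim)

theorem unguardedVars_subset_freeVars (φ : Formula Var P) : φ.unguardedVars ⊆ φ.freeVars := by
  induction φ with
  | pos p => exact subset_rfl
  | neg p => exact subset_rfl
  | var x => exact subset_rfl
  | disj Γ ih => exact Set.iUnion_mono ih
  | conj Γ ih => exact Set.iUnion_mono ih
  | nabla Γ ih => exact Set.empty_subset _
  | mu x φ ih => exact Set.sdiff_subset_sdiff_left ih
  | nu x φ ih => exact Set.sdiff_subset_sdiff_left ih

theorem Closed.guarded {φ : Formula Var P} (h : φ.Closed) : φ.Guarded :=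
  Set.subset_empty_iff.1 (φ.unguardedVars_subset_freeVars.trans h.subset)

/-- A recursive form of `QF` over the variables in `X` and the closed formulas: only the quantified
subformulas are required to be closed, since a closed `⋁`, `⋀` or `∇` has closed members. -/
def QFOver (X : Finset Var) : Formula Var P → Prop
  | pos _ => True
  | neg _ => True
  | var x => x ∈ X
  | disj Γ => ∀ i, (Γ i).QFOver X
  | conj Γ => ∀ i, (Γ i).QFOver X
  | nabla Γ => ∀ i, (Γ i).QFOver X
  | mu x φ => (mu x φ).Closed
  | nu x φ => (nu x φ).Closed

theorem Closed.qfOver (X : Finset Var) {φ : Formula Var P} (h : φ.Closed) : φ.QFOver X := by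
  induction φ with
  | pos p => trivial
  | neg p => trivial
  | var x => exact absurd h (Set.singleton_ne_empty x)
  | disj Γ ih => exact fun i => ih i (Set.iUnion_eq_empty.1 h i)
  | conj Γ ih => exact fun i => ih i (Set.iUnion_eq_empty.1 h i)
  | nabla Γ ih => exact fun i => ih i (Set.iUnion_eq_empty.1 h i)
  | mu x φ ih => exact h
  | nu x φ ih => exact h

theorem QF.qfOver {X : Finset Var} {φ : Formula Var P}
    (h : φ.QF ({φ | ∃ y ∈ X, φ = Formula.var y} ∪ {φ | φ.Closed})) : φ.QFOver X := by
  induction h with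
  | base h =>
    rcases h with ⟨y, hy, rfl⟩ | h
    · exact hy
    · exact h.qfOver X
  | pos p => trivial
  | neg p => trivial
  | disj h ih => exact ih
  | conj h ih => exact ih
  | nabla h ih => exact ih

open Classical in
/-- The members of the families `Γ` of the subformulas `∇Γ`, at all modal depths outside of
fixed-point quantifiers. -/
noncomputable def modalArgs : Formula Var P → Finset (Formula Var P)
  | disj Γ => Finset.univ.biUnion fun i => (Γ i).modalArgs
  | conj Γ => Finset.univ.biUnion fun i => (Γ i).modalArgs
  | nabla Γ => Finset.univ.biUnion fun i => insert (Γ i) (Γ i).modalArgs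
  | _ => ∅

open Classical in
theorem modalArgs_subset_of_mem {φ ψ : Formula Var P} (h : ψ ∈ φ.modalArgs) :
    ψ.modalArgs ⊆ φ.modalArgs := by
  induction φ with
  | pos p => simp [modalArgs] at h
  | neg p => simp [modalArgs] at h
  | var x => simp [modalArgs] at h
  | disj Γ ih =>
    simp only [modalArgs, Finset.mem_biUnion, Finset.mem_univ, true_and] at h
    obtain ⟨i, hi⟩ := h
    exact (ih i hi).trans (Finset.subset_biUnion_of_mem (fun i => (Γ i).modalArgs)
      (Finset.mem_univ i))
  | conj Γ ih =>
    simp only [modalArgs, Finset.mem_biUnion, Finset.mem_univ, true_and] at h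
    obtain ⟨i, hi⟩ := h
    exact (ih i hi).trans (Finset.subset_biUnion_of_mem (fun i => (Γ i).modalArgs)
      (Finset.mem_univ i))
  | nabla Γ ih =>
    simp only [modalArgs, Finset.mem_biUnion, Finset.mem_univ, true_and, Finset.mem_insert] at h
    obtain ⟨i, hi⟩ := h
    intro χ hχ
    simp only [modalArgs, Finset.mem_biUnion, Finset.mem_univ, true_and, Finset.mem_insert]
    refine ⟨i, Or.inr ?_⟩
    rcases hi with rfl | hi
    · exact hχ
    · exact ih i hi hχ
  | mu x φ ih => simp [modalArgs] at h
  | nu x φ ih => simp [modalArgs] at h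

theorem QFOver.of_mem_modalArgs {X : Finset Var} {φ ψ : Formula Var P} (hφ : φ.QFOver X)
    (h : ψ ∈ φ.modalArgs) : ψ.QFOver X := by
  induction φ with
  | pos p => simp [modalArgs] at h
  | neg p => simp [modalArgs] at h
  | var x => simp [modalArgs] at h
  | disj Γ ih =>
    simp only [modalArgs, Finset.mem_biUnion, Finset.mem_univ, true_and] at h
    obtain ⟨i, hi⟩ := h
    exact ih i (hφ i) hi
  | conj Γ ih =>
    simp only [modalArgs, Finset.mem_biUnion, Finset.mem_univ, true_and] at h
    obtain ⟨i, hi⟩ := h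
    exact ih i (hφ i) hi
  | nabla Γ ih =>
    simp only [modalArgs, Finset.mem_biUnion, Finset.mem_univ, true_and, Finset.mem_insert] at h
    obtain ⟨i, rfl | hi⟩ := h
    · exact hφ i
    · exact ih i (hφ i) hi
  | mu x φ ih => simp [modalArgs] at h
  | nu x φ ih => simp [modalArgs] at h

/-- The nesting depth of `∇` outside of fixed-point quantifiers. -/
def modalDepth : Formula Var P → ℕ
  | disj Γ => Finset.univ.sup fun i => (Γ i).modalDepth
  | conj Γ => Finset.univ.sup fun i => (Γ i).modalDepth
  | nabla Γ => (Finset.univ.sup fun i => (Γ i).modalDepth) + 1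
  | _ => 0

theorem modalDepth_lt_of_mem_modalArgs {φ ψ : Formula Var P} (h : ψ ∈ φ.modalArgs) :
    ψ.modalDepth < φ.modalDepth := by
  induction φ with
  | pos p => simp [modalArgs] at h
  | neg p => simp [modalArgs] at h
  | var x => simp [modalArgs] at h
  | disj Γ ih =>
    simp only [modalArgs, Finset.mem_biUnion, Finset.mem_univ, true_and] at h
    obtain ⟨i, hi⟩ := h
    exact (ih i hi).trans_le (Finset.le_sup (f := fun i => (Γ i).modalDepth) (Finset.mem_univ i))
  | conj Γ ih =>
    simp only [modalArgs, Finset.mem_biUnion, Finset.mem_univ, true_and] at h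
    obtain ⟨i, hi⟩ := h
    exact (ih i hi).trans_le (Finset.le_sup (f := fun i => (Γ i).modalDepth) (Finset.mem_univ i))
  | nabla Γ ih =>
    simp only [modalArgs, Finset.mem_biUnion, Finset.mem_univ, true_and, Finset.mem_insert] at h
    obtain ⟨i, hi⟩ := h
    refine Nat.lt_succ_of_le (le_trans ?_
      (Finset.le_sup (f := fun i => (Γ i).modalDepth) (Finset.mem_univ i)))
    rcases hi with rfl | hi
    · exact le_rfl
    · exact (ih i hi).le
  | mu x φ ih => simp [modalArgs] at h
  | nu x φ ih => simp [modalArgs] at h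

end Formula

/-! ### Conjunctive normal forms -/

/-- A clause `⋁ Γ ∨ ∇{⋁ A | A ∈ Y}`, where `Γ` is the list `closed` and `Y` is the set `modal` of
finite sets `A` of formulas. That the formulas in `closed` are closed is not part of the structure:
it is proved for the normal forms `Formula.cnf`. -/
structure Clause (Var P : Type*) where
  closed : List (Formula Var P)
  modal : Finset (Finset (Formula Var P))

namespace Clause

variable {Var P S : Type*}

/-- The denotation of a clause when the formulas below `∇` are interpreted by `W`. The formulas in
`closed` are evaluated at the empty valuation, which does not matter for closed formulas. -/
def den [DecidableEq Var] (F : Frame P S) (W : Formula Var P → Set S) (c : Clause Var P) : Set S :=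
  {s | ∃ γ ∈ c.closed, s ∈ γ.den F fun _ => ∅} ∪
    F.nabla ((fun A : Finset (Formula Var P) => ⋃ ψ ∈ A, W ψ) '' (c.modal : Set (Finset _)))

open Classical in
/-- Clauses whose conjunction is the disjunction of two clauses, by the distributive law for `∇`. -/
noncomputable def or (c d : Clause Var P) : List (Clause Var P) :=
  ((c.modal ×ˢ d.modal).powerset.filter fun Z =>
      (∀ A ∈ c.modal, ∃ B, (A, B) ∈ Z) ∧ ∀ B ∈ d.modal, ∃ A, (A, B) ∈ Z).toList.map
    fun Z => ⟨c.closed ++ d.closed, Z.image fun p => p.1 ∪ p.2⟩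

/-- The conjunction of a list of clauses. -/
def listDen [DecidableEq Var] (F : Frame P S) (W : Formula Var P → Set S)
    (l : List (Clause Var P)) : Set S :=
  {s | ∀ c ∈ l, s ∈ c.den F W}

/-- The disjunction of two lists of clauses. -/
noncomputable def listOr (l m : List (Clause Var P)) : List (Clause Var P) :=
  l.flatMap fun c => m.flatMap fun d => c.or d

/-- The disjunction of the closed formulas in `Γ` as a list of clauses. As no `∇Y` is identically
false, two clauses are needed: `∇∅` holds exactly at the states with a successor, and `∇{⊥}`, with
`⊥` the empty disjunction, exactly at those without. -/
def ofClosed (Γ : List (Formula Var P)) : List (Clause Var P) :=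
  [⟨Γ, ∅⟩, ⟨Γ, {∅}⟩]

/-- The disjunction of a list of lists of clauses. -/
noncomputable def listSup (L : List (List (Clause Var P))) : List (Clause Var P) :=
  L.foldr listOr (ofClosed [])

section

variable [DecidableEq Var] (F : Frame P S) (W : Formula Var P → Set S)

open Classical in
theorem listDen_or (c d : Clause Var P) :
    listDen F W (c.or d) = c.den F W ∪ d.den F W := by
  have key : ∀ s, s ∈ listDen F W (c.or d) ↔
      ∀ Z ⊆ c.modal ×ˢ d.modal, (∀ A ∈ c.modal, ∃ B, (A, B) ∈ Z) →
        (∀ B ∈ d.modal, ∃ A, (A, B) ∈ Z) →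
        ((∃ γ ∈ c.closed, s ∈ γ.den F fun _ => ∅) ∨ ∃ γ ∈ d.closed, s ∈ γ.den F fun _ => ∅) ∨
        s ∈ F.nabla ((fun p : Finset (Formula Var P) × Finset (Formula Var P) =>
          (⋃ ψ ∈ p.1, W ψ) ∪ ⋃ ψ ∈ p.2, W ψ) '' (Z : Set (Finset _ × Finset _))) := by
    intro s
    have hden : ∀ Z : Finset (Finset (Formula Var P) × Finset (Formula Var P)),
        s ∈ den F W ⟨c.closed ++ d.closed, Z.image fun p => p.1 ∪ p.2⟩ ↔ _ ∨ _ :=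
      fun Z => Iff.rfl
    simp only [List.mem_append, or_and_right, exists_or, Finset.coe_image, Set.image_image,
      Finset.mem_union, Set.iUnion_or, Set.iUnion_union_distrib] at hden
    simp only [listDen, or, List.forall_mem_map, Finset.mem_toList, Finset.mem_filter,
      Finset.mem_powerset, Set.mem_ofPred_eq, and_imp]
    exact forall_congr' fun Z => forall₃_congr fun _ _ _ => hden Z
  ext s
  rw [key]
  simp only [den, Set.mem_union, Set.mem_ofPred_eq]
  rw [or_or_or_comm]
  by_cases hcl : (∃ γ ∈ c.closed, s ∈ γ.den F fun _ => ∅) ∨ ∃ γ ∈ d.closed, s ∈ γ.den F fun _ => ∅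
  · simp [hcl]
  simp only [hcl, false_or]
  rw [Frame.mem_nabla_or_mem_nabla_iff]
  constructor
  · intro h Z hZ hA hB
    have hfin : Z.Finite := (c.modal ×ˢ d.modal).finite_toSet.subset (by simpa using hZ)
    lift Z to Finset (Finset (Formula Var P) × Finset (Formula Var P)) using hfin
    exact h Z (by rw [← Finset.coe_subset]; simpa using hZ) (by simpa using hA) (by simpa using hB)
  · intro h Z hZ hA hB
    refine h Z ?_ (by simpa using hA) (by simpa using hB)
    rw [← Finset.coe_subset] at hZ
    simpa using hZ

theorem listDen_listOr (l m : List (Clause Var P)) :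
    listDen F W (listOr l m) = listDen F W l ∪ listDen F W m := by
  ext s
  have h : ∀ c d : Clause Var P, (∀ e ∈ c.or d, s ∈ e.den F W) ↔ s ∈ c.den F W ∨ s ∈ d.den F W :=
    fun c d => Set.ext_iff.1 (listDen_or F W c d) s
  have h' : s ∈ listDen F W (listOr l m) ↔
      ∀ c ∈ l, ∀ d ∈ m, s ∈ c.den F W ∨ s ∈ d.den F W := by
    simp only [← h, listDen, listOr, List.mem_flatMap, Set.mem_ofPred_eq]
    exact ⟨fun H c hc d hd e he => H e ⟨c, hc, d, hd, he⟩,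
      fun H e ⟨c, hc, d, hd, he⟩ => H c hc d hd e he⟩
  rw [h']
  constructor
  · intro H
    by_contra hcon
    simp only [listDen, Set.mem_union, Set.mem_ofPred_eq, not_or, not_forall] at hcon
    obtain ⟨⟨c, hc, hcs⟩, d, hd, hds⟩ := hcon
    exact (H c hc d hd).elim hcs hds
  · rintro (H | H) c hc d hd
    · exact Or.inl (H c hc)
    · exact Or.inr (H d hd)

theorem listDen_ofClosed (Γ : List (Formula Var P)) :
    listDen F W (ofClosed Γ) = {s | ∃ γ ∈ Γ, s ∈ γ.den F fun _ => ∅} := by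
  ext s
  simp only [listDen, ofClosed, List.mem_cons, List.not_mem_nil, or_false, forall_eq_or_imp,
    forall_eq, den, Set.mem_union, Set.mem_ofPred_eq, Frame.mem_nabla_image]
  constructor
  · rintro ⟨h | h, h' | h'⟩
    · exact h
    · exact h
    · exact h'
    · simp at h h'
      obtain ⟨t, ht⟩ := h
      exact absurd ht (h' t)
  · exact fun h => ⟨Or.inl h, Or.inl h⟩

theorem mem_listDen_listSup (L : List (List (Clause Var P))) (s : S) :
    s ∈ listDen F W (listSup L) ↔ ∃ l ∈ L, s ∈ listDen F W l := by
  induction L with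
  | nil => simp [listSup, listDen_ofClosed]
  | cons l L ih =>
    have : listSup (l :: L) = listOr l (listSup L) := rfl
    rw [this, listDen_listOr, Set.mem_union, ih]
    simp

theorem mem_listDen_flatten (L : List (List (Clause Var P))) (s : S) :
    s ∈ listDen F W L.flatten ↔ ∀ l ∈ L, s ∈ listDen F W l := by
  simp only [listDen, List.mem_flatten, Set.mem_ofPred_eq]
  exact ⟨fun H l hl c hc => H c ⟨l, hl, hc⟩, fun H c ⟨l, hl, hc⟩ => H l hl c hc⟩

end

/-- All formulas in `closed` are closed, and all formulas below `∇` belong to `T`. -/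
def Over (T : Finset (Formula Var P)) (c : Clause Var P) : Prop :=
  (∀ γ ∈ c.closed, γ.Closed) ∧ ∀ A ∈ c.modal, A ⊆ T

variable {T : Finset (Formula Var P)}

theorem Over.or {c d : Clause Var P} (hc : c.Over T) (hd : d.Over T) : ∀ e ∈ c.or d, e.Over T := by
  classical
  intro e he
  simp only [Clause.or, List.mem_map, Finset.mem_toList, Finset.mem_filter,
    Finset.mem_powerset] at he
  obtain ⟨Z, ⟨hZ, -⟩, rfl⟩ := he
  refine ⟨fun γ hγ => (List.mem_append.1 hγ).elim (hc.1 γ) (hd.1 γ), fun A hA => ?_⟩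
  obtain ⟨p, hp, rfl⟩ := Finset.mem_image.1 hA
  have := Finset.mem_product.1 (hZ hp)
  exact Finset.union_subset (hc.2 _ this.1) (hd.2 _ this.2)

theorem over_listOr {l m : List (Clause Var P)} (hl : ∀ c ∈ l, c.Over T) (hm : ∀ c ∈ m, c.Over T) :
    ∀ c ∈ listOr l m, c.Over T := by
  intro e he
  simp only [listOr, List.mem_flatMap] at he
  obtain ⟨c, hc, d, hd, he⟩ := he
  exact (hl c hc).or (hm d hd) e he

theorem over_ofClosed {Γ : List (Formula Var P)} (h : ∀ γ ∈ Γ, γ.Closed) :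
    ∀ c ∈ ofClosed Γ, c.Over T := by
  intro c hc
  simp only [ofClosed, List.mem_cons, List.not_mem_nil, or_false] at hc
  rcases hc with rfl | rfl
  · exact ⟨h, by simp⟩
  · exact ⟨h, by simp⟩

theorem over_listSup {L : List (List (Clause Var P))} (h : ∀ l ∈ L, ∀ c ∈ l, c.Over T) :
    ∀ c ∈ listSup L, c.Over T := by
  induction L with
  | nil => exact over_ofClosed (by simp)
  | cons l L ih =>
    exact over_listOr (h l (by simp)) (ih fun l hl => h l (by simp [hl]))

theorem over_flatten {L : List (List (Clause Var P))} (h : ∀ l ∈ L, ∀ c ∈ l, c.Over T) :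
    ∀ c ∈ L.flatten, c.Over T := by
  intro c hc
  obtain ⟨l, hl, hc⟩ := List.mem_flatten.1 hc
  exact h l hl c hc

end Clause

namespace Formula

variable {Var P S : Type*}

open Classical in
/-- The conjunctive normal form of a quantifier-free formula: the members of each `∇Γ` become
singletons and are not analysed further, and an unguarded variable `y` is replaced by `e y`. -/
noncomputable def cnf (e : Var → List (Clause Var P)) : Formula Var P → List (Clause Var P)
  | var y => e y
  | disj Γ => Clause.listSup (List.ofFn fun i => (Γ i).cnf e)
  | conj Γ => (List.ofFn fun i => (Γ i).cnf e).flatten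
  | nabla Γ => [⟨[], Finset.univ.image fun i => {Γ i}⟩]
  | pos p => Clause.ofClosed [pos p]
  | neg p => Clause.ofClosed [neg p]
  | mu x φ => Clause.ofClosed [mu x φ]
  | nu x φ => Clause.ofClosed [nu x φ]

theorem mem_listDen_cnf_nabla [DecidableEq Var] (F : Frame P S) (W : Formula Var P → Set S)
    (e : Var → List (Clause Var P)) {n : ℕ} (Γ : Fin n → Formula Var P) :
    Clause.listDen F W ((nabla Γ).cnf e) = F.nabla (Set.range fun i => W (Γ i)) := by
  ext s
  simp only [cnf, Clause.listDen, List.mem_cons, List.not_mem_nil, or_false, forall_eq, Clause.den,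
    Set.mem_ofPred_eq, Set.mem_union, false_and, exists_false, false_or, Finset.coe_image,
    Finset.coe_univ, Set.image_univ, ← Set.range_comp]
  simp [Function.comp_def]

/-- The denotation of a normal form is bounded by that of the formula, if this is so for the
members of its modalities and for its unguarded variables. -/
theorem listDen_cnf_subset [DecidableEq Var] {X : Finset Var} (F : Frame P S)
    {W : Formula Var P → Set S} {V : Var → Set S} {e : Var → List (Clause Var P)}
    {φ : Formula Var P} (hφ : φ.QFOver X) (hW : ∀ ψ ∈ φ.modalArgs, W ψ ⊆ ψ.den F V)
    (he : ∀ y ∈ φ.unguardedVars, y ∈ X → Clause.listDen F W (e y) ⊆ V y) :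
    Clause.listDen F W (φ.cnf e) ⊆ φ.den F V := by
  induction φ with
  | pos p => simp [cnf, Clause.listDen_ofClosed, den]
  | neg p => simp [cnf, Clause.listDen_ofClosed, den, Set.subset_def]
  | var y => exact he y rfl hφ
  | disj Γ ih =>
    intro s hs
    rw [cnf, Clause.mem_listDen_listSup] at hs
    obtain ⟨l, hl, hs⟩ := hs
    obtain ⟨i, rfl⟩ := List.mem_ofFn.1 hl
    refine Set.mem_iUnion_of_mem i (ih i (hφ i) (fun ψ hψ => hW ψ ?_)
      (fun y hy => he y (Set.mem_iUnion_of_mem i hy)) hs)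
    simp only [modalArgs, Finset.mem_biUnion, Finset.mem_univ, true_and]
    exact ⟨i, hψ⟩
  | conj Γ ih =>
    intro s hs
    rw [cnf, Clause.mem_listDen_flatten] at hs
    refine Set.mem_iInter.2 fun i => ih i (hφ i) (fun ψ hψ => hW ψ ?_)
      (fun y hy => he y (Set.mem_iUnion_of_mem i hy)) (hs _ (List.mem_ofFn.2 ⟨i, rfl⟩))
    simp only [modalArgs, Finset.mem_biUnion, Finset.mem_univ, true_and]
    exact ⟨i, hψ⟩
  | nabla Γ ih =>
    rw [mem_listDen_cnf_nabla]
    refine F.nabla_range_mono fun i => hW _ ?_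
    simp only [modalArgs, Finset.mem_biUnion, Finset.mem_univ, true_and, Finset.mem_insert]
    exact ⟨i, Or.inl rfl⟩
  | mu x φ ih =>
    rw [Closed.den_eq F hφ V fun _ => ∅]
    simp [cnf, Clause.listDen_ofClosed]
  | nu x φ ih =>
    rw [Closed.den_eq F hφ V fun _ => ∅]
    simp [cnf, Clause.listDen_ofClosed]

/-- The converse bound to `listDen_cnf_subset`. -/
theorem subset_listDen_cnf [DecidableEq Var] {X : Finset Var} (F : Frame P S)
    {W : Formula Var P → Set S} {V : Var → Set S} {e : Var → List (Clause Var P)}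
    {φ : Formula Var P} (hφ : φ.QFOver X) (hW : ∀ ψ ∈ φ.modalArgs, ψ.den F V ⊆ W ψ)
    (he : ∀ y ∈ φ.unguardedVars, y ∈ X → V y ⊆ Clause.listDen F W (e y)) :
    φ.den F V ⊆ Clause.listDen F W (φ.cnf e) := by
  induction φ with
  | pos p => simp [cnf, Clause.listDen_ofClosed, den]
  | neg p => simp [cnf, Clause.listDen_ofClosed, den, Set.subset_def]
  | var y => exact he y rfl hφ
  | disj Γ ih =>
    intro s hs
    rw [cnf, Clause.mem_listDen_listSup]
    obtain ⟨i, hs⟩ := Set.mem_iUnion.1 hs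
    refine ⟨_, List.mem_ofFn.2 ⟨i, rfl⟩, ih i (hφ i) (fun ψ hψ => hW ψ ?_)
      (fun y hy => he y (Set.mem_iUnion_of_mem i hy)) hs⟩
    simp only [modalArgs, Finset.mem_biUnion, Finset.mem_univ, true_and]
    exact ⟨i, hψ⟩
  | conj Γ ih =>
    intro s hs
    rw [cnf, Clause.mem_listDen_flatten]
    intro l hl
    obtain ⟨i, rfl⟩ := List.mem_ofFn.1 hl
    refine ih i (hφ i) (fun ψ hψ => hW ψ ?_)
      (fun y hy => he y (Set.mem_iUnion_of_mem i hy)) (Set.mem_iInter.1 hs i)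
    simp only [modalArgs, Finset.mem_biUnion, Finset.mem_univ, true_and]
    exact ⟨i, hψ⟩
  | nabla Γ ih =>
    rw [mem_listDen_cnf_nabla]
    refine F.nabla_range_mono fun i => hW _ ?_
    simp only [modalArgs, Finset.mem_biUnion, Finset.mem_univ, true_and, Finset.mem_insert]
    exact ⟨i, Or.inl rfl⟩
  | mu x φ ih =>
    rw [Closed.den_eq F hφ V fun _ => ∅]
    simp [cnf, Clause.listDen_ofClosed]
  | nu x φ ih =>
    rw [Closed.den_eq F hφ V fun _ => ∅]
    simp [cnf, Clause.listDen_ofClosed]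

theorem over_cnf {X : Finset Var} {T : Finset (Formula Var P)} {e : Var → List (Clause Var P)}
    {φ : Formula Var P} (hφ : φ.QFOver X) (hT : φ.modalArgs ⊆ T)
    (he : ∀ y ∈ X, ∀ c ∈ e y, c.Over T) : ∀ c ∈ φ.cnf e, c.Over T := by
  induction φ with
  | pos p => exact Clause.over_ofClosed (by simp [Closed, freeVars])
  | neg p => exact Clause.over_ofClosed (by simp [Closed, freeVars])
  | var y => exact he y hφ
  | disj Γ ih =>
    refine Clause.over_listSup fun l hl => ?_
    obtain ⟨i, rfl⟩ := List.mem_ofFn.1 hl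
    refine ih i (hφ i) (Finset.Subset.trans (fun ψ hψ => ?_) hT)
    simp only [modalArgs, Finset.mem_biUnion, Finset.mem_univ, true_and]
    exact ⟨i, hψ⟩
  | conj Γ ih =>
    refine Clause.over_flatten fun l hl => ?_
    obtain ⟨i, rfl⟩ := List.mem_ofFn.1 hl
    refine ih i (hφ i) (Finset.Subset.trans (fun ψ hψ => ?_) hT)
    simp only [modalArgs, Finset.mem_biUnion, Finset.mem_univ, true_and]
    exact ⟨i, hψ⟩
  | nabla Γ ih =>
    intro c hc
    rw [cnf, List.mem_singleton] at hc
    subst hc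
    refine ⟨by simp, fun A hA => ?_⟩
    classical
    obtain ⟨i, -, rfl⟩ := Finset.mem_image.1 hA
    refine Finset.singleton_subset_iff.2 (hT ?_)
    simp only [modalArgs, Finset.mem_biUnion, Finset.mem_univ, true_and, Finset.mem_insert]
    exact ⟨i, Or.inl rfl⟩
  | mu x φ ih => exact Clause.over_ofClosed (List.forall_mem_singleton.2 hφ)
  | nu x φ ih => exact Clause.over_ofClosed (List.forall_mem_singleton.2 hφ)

end Formula

namespace Clause

variable {Var P S : Type*}

/-- The formula of a conjunctive equation system that a list of clauses stands for, when the
disjunction of a finite set `A` of formulas is named by the variable `enc A`. -/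
noncomputable def toFormula (enc : Finset (Formula Var P) → Var) (l : List (Clause Var P)) :
    Formula Var P :=
  Formula.conj fun i : Fin l.length =>
    (Formula.disj fun j : Fin l[i].closed.length => l[i].closed[j]).or
      (Formula.nabla fun j : Fin l[i].modal.toList.length =>
        Formula.var (enc l[i].modal.toList[j]))

theorem den_toFormula [DecidableEq Var] (F : Frame P S) {T : Finset (Formula Var P)}
    {enc : Finset (Formula Var P) → Var} {l : List (Clause Var P)} (hl : ∀ c ∈ l, c.Over T)
    {V : Var → Set S} {W : Formula Var P → Set S} (hV : ∀ A ⊆ T, V (enc A) = ⋃ ψ ∈ A, W ψ) :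
    (toFormula enc l).den F V = listDen F W l := by
  have key : ∀ c ∈ l, ((Formula.disj fun j : Fin c.closed.length => c.closed[j]).or
      (Formula.nabla fun j : Fin c.modal.toList.length =>
        Formula.var (enc c.modal.toList[j]))).den F V = c.den F W := by
    intro c hc
    have h₁ : (Formula.disj fun j : Fin c.closed.length => c.closed[j]).den F V =
        {s | ∃ γ ∈ c.closed, s ∈ γ.den F fun _ => ∅} := by
      ext s
      simp only [Formula.den, Set.mem_iUnion, Set.mem_ofPred_eq]
      constructor
      · rintro ⟨j, hj⟩
        have hj' := (hl c hc).1 c.closed[j] (List.getElem_mem _)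
        exact ⟨_, List.getElem_mem _, (hj'.den_eq F V _).subset hj⟩
      · rintro ⟨γ, hγ, hs⟩
        obtain ⟨j, hj, rfl⟩ := List.getElem_of_mem hγ
        exact ⟨⟨j, hj⟩, (((hl c hc).1 _ hγ).den_eq F _ V).subset hs⟩
    have h₂ : (Set.range fun j : Fin c.modal.toList.length => V (enc c.modal.toList[j])) =
        (fun A : Finset (Formula Var P) => ⋃ ψ ∈ A, W ψ) '' (c.modal : Set (Finset _)) := by
      ext U
      constructor
      · rintro ⟨j, rfl⟩
        have hj : c.modal.toList[j] ∈ c.modal := Finset.mem_toList.1 (List.getElem_mem _)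
        exact ⟨_, hj, (hV _ ((hl c hc).2 _ hj)).symm⟩
      · rintro ⟨A, hA, rfl⟩
        obtain ⟨j, hj, rfl⟩ := List.getElem_of_mem (Finset.mem_toList.2 hA)
        exact ⟨⟨j, hj⟩, hV _ ((hl c hc).2 _ hA)⟩
    ext s
    rw [den, ← h₁, ← h₂]
    simp [Formula.or, Formula.den, Set.mem_iUnion, Fin.exists_fin_two]
  ext s
  simp only [toFormula, Formula.den, Set.mem_iInter, listDen, Set.mem_ofPred_eq]
  constructor
  · intro h c hc
    obtain ⟨i, hi, rfl⟩ := List.getElem_of_mem hc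
    rw [← key _ (List.getElem_mem _)]
    exact h ⟨i, hi⟩
  · intro h i
    rw [key l[i] (List.getElem_mem _)]
    exact h _ (List.getElem_mem _)

end Clause

/-! ### Approximants and closure ordinals -/

theorem omega0_mul_add_one_lt_omega_one {α : Ordinal.{0}} (h : α < Ordinal.omega 1) :
    Ordinal.omega0 * α + 1 < Ordinal.omega 1 := by
  have h₁ : Ordinal.omega0 * α < Ordinal.omega 1 := by
    rw [← Cardinal.ord_aleph, Cardinal.lt_ord] at h ⊢
    rw [Ordinal.card_mul]
    exact Cardinal.mul_lt_of_lt (Cardinal.aleph0_le_aleph 1) (by simp) h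
  rw [← Order.succ_eq_add_one]
  exact (Cardinal.isSuccLimit_omega 1).succ_lt h₁

namespace EquationSystem

variable {Var P S : Type*}

theorem qfOver_E (Q : EquationSystem Var P) (x : {x // x ∈ Q.X}) : (Q.E x).QFOver Q.X :=
  (Q.qf x).qfOver

variable [DecidableEq Var]

theorem mem_approx (Q : EquationSystem Var P) (F : Frame P S) (α : Ordinal.{0}) (x : Var) (s : S) :
    s ∈ Q.approx F α x ↔ ∃ h : x ∈ Q.X, ∃ β < α, s ∈ (Q.E ⟨x, h⟩).den F (Q.approx F β) := by
  rw [approx]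
  by_cases h : x ∈ Q.X
  · simp [h]
  · simp [h]

theorem approx_mono (Q : EquationSystem Var P) (F : Frame P S) {α β : Ordinal.{0}} (h : α ≤ β)
    (x : Var) : Q.approx F α x ⊆ Q.approx F β x := by
  intro s hs
  rw [mem_approx] at hs ⊢
  obtain ⟨hx, γ, hγ, hs⟩ := hs
  exact ⟨hx, γ, hγ.trans_le h, hs⟩

end EquationSystem

namespace EquationalFormula

variable {Var P S : Type*} [DecidableEq Var]

theorem approxDen_mono (φ : EquationalFormula Var P) (F : Frame P S) {α β : Ordinal.{0}}
    (h : α ≤ β) : φ.approxDen F α ⊆ φ.approxDen F β :=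
  φ.toEquationSystem.approx_mono F h φ.init

theorem approxDen_subset_den (φ : EquationalFormula Var P) (F : Frame P S) {α : Ordinal.{0}}
    (h : α ≤ Ordinal.omega 1) : φ.approxDen F α ⊆ φ.den F :=
  (φ.approxDen_mono F h).trans (φ.approxDen_omega_one F).subset

theorem approxDen_closureOrdinalIn (φ : EquationalFormula Var P) (F : Frame P S) :
    φ.approxDen F (φ.closureOrdinalIn F) = φ.den F :=
  csInf_mem (s := {κ | φ.approxDen F κ = φ.den F}) ⟨_, φ.approxDen_omega_one F⟩

theorem closureOrdinalIn_le_closureOrdinal (φ : EquationalFormula Var P) {S : Type} [Countable S]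
    (F : Frame P S) : φ.closureOrdinalIn F ≤ φ.closureOrdinal :=
  csInf_mem (s := {κ | ∀ (S : Type) (_ : Countable S) (F : Frame P S), φ.closureOrdinalIn F ≤ κ})
    ⟨_, fun _ _ F => φ.closureOrdinalIn_le_omega_one F⟩ S inferInstance F

/-- If the approximants of `ψ` lie below those of `φ`, and each countable approximant of `φ` lies
below a countable approximant of `ψ`, then `φ` and `ψ` are equivalent. -/
theorem den_eq_of_approxDen_subset {φ ψ : EquationalFormula Var P} {F : Frame P S}
    {f : Ordinal.{0} → Ordinal.{0}} (hf : ∀ α < Ordinal.omega 1, f α < Ordinal.omega 1)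
    (h₁ : ∀ α, ψ.approxDen F α ⊆ φ.approxDen F α)
    (h₂ : ∀ α, φ.approxDen F α ⊆ ψ.approxDen F (f α)) : ψ.den F = φ.den F := by
  apply Set.Subset.antisymm
  · exact Set.iUnion₂_mono fun α _ => h₁ α
  · exact Set.iUnion₂_subset fun α hα =>
      (h₂ α).trans (ψ.approxDen_subset_den F (hf α hα).le)

/-- Equivalent formulas with smaller approximants have larger closure ordinals: once the smaller
approximants reach the common denotation, so do the larger ones. -/
theorem closureOrdinal_le_of_approxDen_subset {φ ψ : EquationalFormula Var P}
    (h₁ : ∀ (S : Type) (F : Frame P S) (α), ψ.approxDen F α ⊆ φ.approxDen F α)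
    (hden : ∀ (S : Type) (F : Frame P S), ψ.den F = φ.den F) :
    φ.closureOrdinal ≤ ψ.closureOrdinal := by
  refine csInf_le' fun S _ F => le_trans (csInf_le' ?_) (ψ.closureOrdinalIn_le_closureOrdinal F)
  refine (φ.approxDen_subset_den F (ψ.closureOrdinalIn_le_omega_one F)).antisymm ?_
  rw [← hden, ← ψ.approxDen_closureOrdinalIn F]
  exact h₁ S F _

/-- If `φ` is exhausted at `κ` in all countable frames, and the approximants of the equivalent formula
`ψ` lag behind by at most `f`, then `ψ` is exhausted at `f κ`. -/
theorem closureOrdinal_le_apply_of_approxDen_subset {φ ψ : EquationalFormula Var P}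
    {f : Ordinal.{0} → Ordinal.{0}} (hf : Monotone f) {κ : Ordinal.{0}} (hκ : φ.closureOrdinal ≤ κ)
    (hfκ : f κ ≤ Ordinal.omega 1)
    (h₂ : ∀ (S : Type) (F : Frame P S) (α), φ.approxDen F α ⊆ ψ.approxDen F (f α))
    (hden : ∀ (S : Type) (F : Frame P S), ψ.den F = φ.den F) :
    ψ.closureOrdinal ≤ f κ := by
  refine csInf_le' fun S _ F => csInf_le' ((ψ.approxDen_subset_den F hfκ).antisymm ?_)
  rw [hden, ← φ.approxDen_closureOrdinalIn F]
  exact (h₂ S F _).trans (ψ.approxDen_mono F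
    (hf ((φ.closureOrdinalIn_le_closureOrdinal F).trans hκ)))

end EquationalFormula

/-! ### The conjunctive equation system -/

namespace EquationalFormula

variable {Var P S : Type*} (φ : EquationalFormula Var P)

open Classical in
/-- The formulas that the new variables refer to: the initial variable and all formulas that occur
as members of a modality in the equations. -/
noncomputable def states : Finset (Formula Var P) :=
  insert (Formula.var φ.init) (Finset.univ.biUnion fun x : {x // x ∈ φ.X} => (φ.E x).modalArgs)

theorem var_init_mem_states : Formula.var φ.init ∈ φ.states := by
  simp [states]

theorem modalArgs_E_subset_states (x : {x // x ∈ φ.X}) : (φ.E x).modalArgs ⊆ φ.states := by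
  intro ψ hψ
  classical
  simp only [states, Finset.mem_insert, Finset.mem_biUnion, Finset.mem_univ, true_and]
  exact Or.inr ⟨x, hψ⟩

theorem qfOver_of_mem_states {ψ : Formula Var P} (h : ψ ∈ φ.states) : ψ.QFOver φ.X := by
  simp only [states, Finset.mem_insert, Finset.mem_biUnion, Finset.mem_univ, true_and] at h
  obtain rfl | ⟨x, h⟩ := h
  · exact φ.init_mem
  · exact (φ.qfOver_E x).of_mem_modalArgs h

theorem modalArgs_subset_states {ψ : Formula Var P} (h : ψ ∈ φ.states) :
    ψ.modalArgs ⊆ φ.states := by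
  simp only [states, Finset.mem_insert, Finset.mem_biUnion, Finset.mem_univ, true_and] at h
  obtain rfl | ⟨x, h⟩ := h
  · simp [Formula.modalArgs]
  · exact (Formula.modalArgs_subset_of_mem h).trans (φ.modalArgs_E_subset_states x)

/-- The set of formulas named by a variable under the naming `enc` of sets of states. The value is
junk at variables that are not of the form `enc A`. -/
noncomputable def decode (enc : Finset (Formula Var P) → Var) : Var → Finset (Formula Var P) :=
  Function.invFunOn enc (φ.states.powerset : Set (Finset (Formula Var P)))

theorem decode_enc {φ : EquationalFormula Var P} {enc : Finset (Formula Var P) → Var}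
    (henc : Set.InjOn enc (φ.states.powerset : Set (Finset (Formula Var P))))
    {A : Finset (Formula Var P)} (hA : A ⊆ φ.states) : φ.decode enc (enc A) = A :=
  henc.leftInvOn_invFunOn (Finset.mem_coe.2 (Finset.mem_powerset.2 hA))

variable [DecidableEq Var]

theorem decode_subset_states {enc : Finset (Formula Var P) → Var} {x : Var}
    (hx : x ∈ φ.states.powerset.image enc) : φ.decode enc x ⊆ φ.states := by
  obtain ⟨A, hA, hAx⟩ := Finset.mem_image.1 hx
  exact Finset.mem_powerset.1 (Function.invFunOn_mem ⟨A, hA, hAx⟩)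

/-- The normal form of the right-hand side of the equation for `y`. As this formula is guarded, the
list of clauses substituted for its unguarded variables plays no role. -/
noncomputable def varCnf (y : Var) : List (Clause Var P) :=
  if h : y ∈ φ.X then (φ.E ⟨y, h⟩).cnf fun _ => [] else []

/-- The normal form of a formula, with the unguarded variables unfolded by their equations. -/
noncomputable def stepCnf (ψ : Formula Var P) : List (Clause Var P) :=
  ψ.cnf φ.varCnf

theorem over_stepCnf {ψ : Formula Var P} (h : ψ ∈ φ.states) :
    ∀ c ∈ φ.stepCnf ψ, c.Over φ.states := by
  refine Formula.over_cnf (φ.qfOver_of_mem_states h) (φ.modalArgs_subset_states h) fun y hy => ?_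
  rw [varCnf, dif_pos hy]
  exact Formula.over_cnf (φ.qfOver_E ⟨y, hy⟩) (φ.modalArgs_E_subset_states ⟨y, hy⟩) (by simp)

/-- The normal form of the disjunction of `A`. -/
noncomputable def finsetCnf (A : Finset (Formula Var P)) : List (Clause Var P) :=
  Clause.listSup (A.toList.map φ.stepCnf)

theorem over_finsetCnf {A : Finset (Formula Var P)} (h : A ⊆ φ.states) :
    ∀ c ∈ φ.finsetCnf A, c.Over φ.states := by
  refine Clause.over_listSup fun l hl => ?_
  obtain ⟨ψ, hψ, rfl⟩ := List.mem_map.1 hl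
  exact φ.over_stepCnf (h (Finset.mem_toList.1 hψ))

theorem mem_listDen_finsetCnf (F : Frame P S) (W : Formula Var P → Set S)
    (A : Finset (Formula Var P)) (s : S) :
    s ∈ Clause.listDen F W (φ.finsetCnf A) ↔ ∃ ψ ∈ A, s ∈ Clause.listDen F W (φ.stepCnf ψ) := by
  simp [finsetCnf, Clause.mem_listDen_listSup]

variable (enc : Finset (Formula Var P) → Var)

/-- The conjunctive equational formula of `φ`: its variables are the names `enc A` of the sets `A` of
states, with the disjunction of `A` as the intended meaning. -/
noncomputable def toConjunctive : EquationalFormula Var P where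
  X := φ.states.powerset.image enc
  E x := Clause.toFormula enc (φ.finsetCnf (φ.decode enc x))
  qf x := by
    have hov := φ.over_finsetCnf (φ.decode_subset_states x.2)
    refine .conj fun i => .disj (Fin.forall_fin_two.2 ⟨.disj fun j => .base (Or.inr ?_),
      .nabla fun j => .base (Or.inl ⟨_, ?_, rfl⟩)⟩)
    · exact (hov _ (List.getElem_mem _)).1 _ (List.getElem_mem _)
    · exact Finset.mem_image_of_mem _ (Finset.mem_powerset.2
        ((hov _ (List.getElem_mem _)).2 _ (Finset.mem_toList.1 (List.getElem_mem _))))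
  guarded x := by
    have hov := φ.over_finsetCnf (φ.decode_subset_states x.2)
    refine Set.iUnion_eq_empty.2 fun i => Set.iUnion_eq_empty.2 (Fin.forall_fin_two.2 ⟨?_, rfl⟩)
    exact Set.iUnion_eq_empty.2 fun j =>
      ((hov _ (List.getElem_mem _)).1 _ (List.getElem_mem _)).guarded
  init := enc {Formula.var φ.init}
  init_mem := Finset.mem_image_of_mem _ (Finset.mem_powerset.2
    (Finset.singleton_subset_iff.2 φ.var_init_mem_states))

theorem isConjunctive_toConjunctive : (φ.toConjunctive enc).IsConjunctive := by
  intro x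
  have hov := φ.over_finsetCnf (φ.decode_subset_states x.2)
  refine ⟨_, _, _, _, fun i j => enc
    (φ.finsetCnf (φ.decode enc x))[i].modal.toList[j], ?_, ?_, rfl⟩
  · exact fun i j => (hov _ (List.getElem_mem _)).1 _ (List.getElem_mem _)
  · exact fun i j => Finset.mem_image_of_mem _ (Finset.mem_powerset.2
      ((hov _ (List.getElem_mem _)).2 _ (Finset.mem_toList.1 (List.getElem_mem _))))

/-- The approximant `V^α` of the conjunctive system at the name of `{ψ}`. -/
noncomputable def stateApprox (F : Frame P S) (α : Ordinal.{0}) (ψ : Formula Var P) : Set S :=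
  (φ.toConjunctive enc).approx F α (enc {ψ})

theorem stateApprox_mono (F : Frame P S) {α β : Ordinal.{0}} (h : α ≤ β) (ψ : Formula Var P) :
    φ.stateApprox enc F α ψ ⊆ φ.stateApprox enc F β ψ :=
  (φ.toConjunctive enc).approx_mono F h _

section

variable {φ enc}

theorem mem_toConjunctive_approx_enc
    (henc : Set.InjOn enc (φ.states.powerset : Set (Finset (Formula Var P))))
    {F : Frame P S} {α : Ordinal.{0}}
    (h : ∀ β < α, ∀ A ⊆ φ.states,
      (φ.toConjunctive enc).approx F β (enc A) = ⋃ ψ ∈ A, φ.stateApprox enc F β ψ)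
    {A : Finset (Formula Var P)} (hA : A ⊆ φ.states) (s : S) :
    s ∈ (φ.toConjunctive enc).approx F α (enc A) ↔
      ∃ β < α, ∃ ψ ∈ A, s ∈ Clause.listDen F (φ.stateApprox enc F β) (φ.stepCnf ψ) := by
  have hmem : enc A ∈ (φ.toConjunctive enc).X :=
    Finset.mem_image_of_mem _ (Finset.mem_powerset.2 hA)
  rw [EquationSystem.mem_approx, exists_prop_of_true hmem]
  refine exists_congr fun β => and_congr_right fun hβ => ?_
  have hE : (φ.toConjunctive enc).E ⟨enc A, hmem⟩ = Clause.toFormula enc (φ.finsetCnf A) := by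
    change Clause.toFormula enc (φ.finsetCnf (φ.decode enc (enc A))) = _
    rw [decode_enc henc hA]
  rw [hE, Clause.den_toFormula F (φ.over_finsetCnf hA) (h β hβ), mem_listDen_finsetCnf]

/-- The approximants of the conjunctive system interpret the name of `A` as the disjunction of the
members of `A`, level by level: the normal form of a disjunction is the disjunction of the normal
forms, and the union defining an approximant commutes with it. -/
theorem toConjunctive_approx_enc
    (henc : Set.InjOn enc (φ.states.powerset : Set (Finset (Formula Var P))))
    (F : Frame P S) (α : Ordinal.{0}) : ∀ A ⊆ φ.states,
      (φ.toConjunctive enc).approx F α (enc A) = ⋃ ψ ∈ A, φ.stateApprox enc F α ψ := by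
  induction α using WellFoundedLT.induction with
  | ind α ih =>
    intro A hA
    ext s
    have hsub : ∀ ψ ∈ A, {ψ} ⊆ φ.states := fun ψ hψ => Finset.singleton_subset_iff.2 (hA hψ)
    rw [mem_toConjunctive_approx_enc henc ih hA]
    simp only [Set.mem_iUnion, exists_prop]
    constructor
    · rintro ⟨β, hβ, ψ, hψ, hs⟩
      exact ⟨ψ, hψ, (mem_toConjunctive_approx_enc henc ih (hsub ψ hψ) s).2
        ⟨β, hβ, ψ, Finset.mem_singleton_self ψ, hs⟩⟩
    · rintro ⟨ψ, hψ, hs⟩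
      obtain ⟨β, hβ, χ, hχ, hsχ⟩ := (mem_toConjunctive_approx_enc henc ih (hsub ψ hψ) s).1 hs
      rw [Finset.mem_singleton] at hχ
      subst hχ
      exact ⟨β, hβ, χ, hψ, hsχ⟩

theorem mem_stateApprox
    (henc : Set.InjOn enc (φ.states.powerset : Set (Finset (Formula Var P))))
    (F : Frame P S) (α : Ordinal.{0}) {ψ : Formula Var P} (hψ : ψ ∈ φ.states) (s : S) :
    s ∈ φ.stateApprox enc F α ψ ↔
      ∃ β < α, s ∈ Clause.listDen F (φ.stateApprox enc F β) (φ.stepCnf ψ) := by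
  rw [stateApprox, mem_toConjunctive_approx_enc henc
    (fun β _ => toConjunctive_approx_enc henc F β) (Finset.singleton_subset_iff.2 hψ)]
  simp

/-- Unfolding nested modalities one at a time can only delay the approximants. -/
theorem stateApprox_subset_den
    (henc : Set.InjOn enc (φ.states.powerset : Set (Finset (Formula Var P))))
    (F : Frame P S) (α : Ordinal.{0}) :
    ∀ ψ ∈ φ.states, φ.stateApprox enc F α ψ ⊆ ψ.den F (φ.approx F α) := by
  induction α using WellFoundedLT.induction with
  | ind α ih =>
    intro ψ hψ s hs
    obtain ⟨β, hβ, hs⟩ := (mem_stateApprox henc F α hψ s).1 hs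
    refine Formula.listDen_cnf_subset F (φ.qfOver_of_mem_states hψ) (fun χ hχ => ?_)
      (fun y _ hy t ht => ?_) hs
    · exact (ih β hβ χ (φ.modalArgs_subset_states hψ hχ)).trans
        (χ.den_mono F fun y => φ.approx_mono F hβ.le y)
    · rw [varCnf, dif_pos hy] at ht
      refine (φ.mem_approx F α y t).2 ⟨hy, β, hβ, ?_⟩
      refine Formula.listDen_cnf_subset F (φ.qfOver_E ⟨y, hy⟩)
        (fun χ hχ => ih β hβ χ (φ.modalArgs_E_subset_states _ hχ)) (fun z hz => ?_) ht
      -- `E y` is guarded: it has no unguarded variable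
      rw [φ.guarded ⟨y, hy⟩] at hz
      exact hz.elim

/-- The delay is bounded: each step of `φ` costs the conjunctive system as many steps as the modal
depth of the formulas involved, hence fewer than `ω`. -/
theorem den_subset_stateApprox
    (henc : Set.InjOn enc (φ.states.powerset : Set (Finset (Formula Var P))))
    (F : Frame P S) (α : Ordinal.{0}) :
    ∀ ψ ∈ φ.states, ψ.den F (φ.approx F α) ⊆
      φ.stateApprox enc F (Ordinal.omega0 * α + (ψ.modalDepth + 1 : ℕ)) ψ := by
  induction α using WellFoundedLT.induction with
  | ind α ihα =>
    -- formulas below a `∇` of `ψ` have smaller modal depth, and unguarded variables of `ψ` refer to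
    -- earlier approximants
    suffices h : ∀ n : ℕ, ∀ ψ ∈ φ.states, ψ.modalDepth = n → ψ.den F (φ.approx F α) ⊆
        φ.stateApprox enc F (Ordinal.omega0 * α + (n + 1 : ℕ)) ψ from
      fun ψ hψ => h _ ψ hψ rfl
    intro n
    induction n using Nat.strong_induction_on with
    | h n ihn =>
      intro ψ hψ hn s hs
      refine (mem_stateApprox henc F _ hψ s).2 ⟨Ordinal.omega0 * α + n, ?_, ?_⟩
      · gcongr
        exact_mod_cast n.lt_succ_self
      refine Formula.subset_listDen_cnf F (φ.qfOver_of_mem_states hψ) (fun χ hχ => ?_)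
        (fun y _ hy t ht => ?_) hs
      · have hlt : χ.modalDepth < n := hn ▸ Formula.modalDepth_lt_of_mem_modalArgs hχ
        refine (ihn _ hlt χ (φ.modalArgs_subset_states hψ hχ) rfl).trans
          (φ.stateApprox_mono enc F ?_ χ)
        gcongr
        exact_mod_cast hlt
      · obtain ⟨_, β, hβ, ht⟩ := (φ.mem_approx F α y t).1 ht
        rw [varCnf, dif_pos hy]
        refine Formula.subset_listDen_cnf F (φ.qfOver_E ⟨y, hy⟩) (fun χ hχ => ?_)
          (fun z hz => ?_) ht
        · refine (ihα β hβ χ (φ.modalArgs_E_subset_states _ hχ)).trans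
            (φ.stateApprox_mono enc F ?_ χ)
          -- `ω * β + k ≤ ω * (β + 1) ≤ ω * α` for finite `k`
          calc Ordinal.omega0 * β + (χ.modalDepth + 1 : ℕ)
              ≤ Ordinal.omega0 * β + Ordinal.omega0 := by
                gcongr
                exact (Ordinal.natCast_lt_omega0 _).le
            _ = Ordinal.omega0 * Order.succ β := (Ordinal.mul_succ _ _).symm
            _ ≤ Ordinal.omega0 * α := by
                gcongr
                exact Order.succ_le_of_lt hβ
            _ ≤ _ := le_self_add
        · -- `E y` is guarded: it has no unguarded variable
          rw [φ.guarded ⟨y, hy⟩] at hz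
          exact hz.elim

theorem toConjunctive_approxDen_subset
    (henc : Set.InjOn enc (φ.states.powerset : Set (Finset (Formula Var P))))
    (F : Frame P S) (α : Ordinal.{0}) :
    (φ.toConjunctive enc).approxDen F α ⊆ φ.approxDen F α :=
  stateApprox_subset_den henc F α _ φ.var_init_mem_states

theorem approxDen_subset_toConjunctive
    (henc : Set.InjOn enc (φ.states.powerset : Set (Finset (Formula Var P))))
    (F : Frame P S) (α : Ordinal.{0}) :
    φ.approxDen F α ⊆ (φ.toConjunctive enc).approxDen F (Ordinal.omega0 * α + 1) := by
  have h := den_subset_stateApprox henc F α _ φ.var_init_mem_states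
  have h₀ : (Formula.var φ.init : Formula Var P).modalDepth = 0 := rfl
  rwa [h₀, zero_add, Nat.cast_one] at h

theorem den_toConjunctive
    (henc : Set.InjOn enc (φ.states.powerset : Set (Finset (Formula Var P))))
    (F : Frame P S) : (φ.toConjunctive enc).den F = φ.den F :=
  den_eq_of_approxDen_subset (fun _ h => omega0_mul_add_one_lt_omega_one h)
    (toConjunctive_approxDen_subset henc F) (approxDen_subset_toConjunctive henc F)

end

end EquationalFormula

end MuCalc

theorem mainTheorem2 {Var P : Type*} [DecidableEq Var] [Infinite Var]
    (φ : MuCalc.EquationalFormula Var P) :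
    ∃ φc : MuCalc.EquationalFormula Var P,
      φc.toEquationSystem.IsConjunctive ∧
      (∀ (S : Type*) (F : MuCalc.Frame P S), φc.den F = φ.den F) ∧
      φ.closureOrdinal ≤ φc.closureOrdinal ∧
      (φ.closureOrdinal < Ordinal.omega 1 → φc.closureOrdinal < Ordinal.omega 1) := by
  obtain ⟨enc, -, henc⟩ := φ.states.powerset.finite_toSet.exists_injOn_of_encard_le
    (t := (Set.univ : Set Var)) (by simp [Set.encard_univ])
  refine ⟨φ.toConjunctive enc, φ.isConjunctive_toConjunctive enc,
    fun S F => MuCalc.EquationalFormula.den_toConjunctive henc F,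
    MuCalc.EquationalFormula.closureOrdinal_le_of_approxDen_subset
      (fun S F => MuCalc.EquationalFormula.toConjunctive_approxDen_subset henc F)
      (fun S F => MuCalc.EquationalFormula.den_toConjunctive henc F), fun hφ => ?_⟩
  have hlt := MuCalc.omega0_mul_add_one_lt_omega_one hφ
  refine (MuCalc.EquationalFormula.closureOrdinal_le_apply_of_approxDen_subset
    (f := fun α => Ordinal.omega0 * α + 1) (fun α β h => ?_) le_rfl hlt.le
    (fun S F => MuCalc.EquationalFormula.approxDen_subset_toConjunctive henc F)
    (fun S F => MuCalc.EquationalFormula.den_toConjunctive henc F)).trans_lt hlt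
  dsimp only
  gcongr
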